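/- **Theorem (Adequacy, or soundness, of $\mathsf{AF2}^{M\mu\nu}$).** *Proof-terms.* $t ::= x \mid \lambda x\,r \mid rs \mid \mathsf{in}\,r \mid \mathsf{out}\,r \mid \mathsf{MRec}\,s\,r \mid \mathsf{MCoRec}\,s\,r$. The contractions are $(\lambda x\,r)s\mapsto r[x:=s]$, $\mathsf{MRec}\,s(\mathsf{in}\,t)\mapsto s(\lambda xx)(\lambda x.\mathsf{MRec}\,s\,x)t$ and $\mathsf{out}(\mathsf{MCoRec}\,s\,t)\mapsto s(\lambda xx)(\lambda x.\mathsf{MCoRec}\,s\,x)t$. Evaluation contexts are $E ::= \bullet\mid E\,s\mid \mathsf{out}\,E\mid \mathsf{MRec}\,s\,E$; $\mathsf{ist}(t)$ is the set of immediate subterms of $t$, and $\mathsf{ist}(E)$ that of $E$ with $\bullet$ read as a variable. Let $\mathsf{prt}((\lambda x\,r)s)=\{s\}$ and $\mathsf{prt}(t)=\varnothing$ for the other redexes. $\mathsf{SN}$ is the least set of terms that contains the variables; contains $\lambda x\,r$, $\mathsf{in}\,r$, $\mathsf{MCoRec}\,s\,r$ if it contains their immediate subterms; contains $E'[E[x]]$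 if $E[x]\in\mathsf{SN}$ and $\mathsf{ist}(E')\subseteq\mathsf{SN}$; and contains $E[t]$ if $t\mapsto t'$, $E[t']\in\mathsf{SN}$ and $\mathsf{prt}(t)\subseteq\mathsf{SN}$. *Saturated sets.* A set $S\subseteq\mathsf{SN}$ is saturated if it contains every $E[x]\in\mathsf{SN}$, and $E[t]\in S$ whenever $t\mapsto t'$, $E[t']\in S$ and $\mathsf{prt}(t)\subseteq\mathsf{SN}$. The saturated sets form a complete lattice $\mathsf{SAT}$ under inclusion; $\mathrm{cl}(X)$ is the least saturated set containing $X\cap\mathsf{SN}$, and $S\Rightarrow T:=\mathrm{cl}\{r\mid\forall s\in S,\ rs\in T\}$. For a non-empty set $M$ let $\mathsf{SAT}_n$ be the complete lattice of functions $M^n\to\mathsf{SAT}$ with the pointwise order. For an arbitrary $\Phi:\mathsf{SAT}_n\to\mathsf{SAT}_n$ and $c_i,d_i:M\to M$ ($1\le i\le n$), with $\vec c(\vec t\,)=(c_1(t_1),\dots,c_n(t_n))$, let $\mu(\Phi)$ be the least fixed point of $$F\mapsto\Big(\vec u\mapsto \mathrm{cl}\bigcup_{F'\subseteq F}\{\mathsf{in}\,r\mid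 r\in\Phi(F')(\vec t\,),\ \vec c(\vec t\,)=\vec u\}\Big)$$ and $\nu(\Phi)$ the greatest fixed point of $$F\mapsto\Big(\vec t\mapsto \mathrm{cl}\bigcap_{F'\supseteq F}\{r\in\mathsf{SN}\mid \mathsf{out}\,r\in\Phi(F')(\vec d(\vec t\,))\}\Big).$$ *Logic.* Over a signature with function and predicate symbols, object terms are the first-order terms, where compositions $f\circ g$ of unary function symbols count as unary function symbols defined by $(f\circ g)(x)=f(g(x))$. Predicates are $\mathcal P::=X\mid P\mid\lambda\vec x.A\mid\mu(\Phi)\mid\nu(\Phi)$ with $\Phi=\lambda X.\mathcal P$ closed and otherwise unrestricted, $\mu(\Phi)$ and $\nu(\Phi)$ of arity $n$ having fixed tuples of $n$ unary constructors $\vec c$ and destructors $\vec d$. Formulas are $A::=\mathcal P(\vec t\,)\mid A\to B\mid\forall x\,A\mid\forall X\,A$, and $(\lambda\vec x.A)(\vec t\,)$ is identified with $A[\vec x:=\vec t\,]$. Write $\Phi(\mathcal R)=\mathcal P[X:=\mathcal R]$ and $\mathcal P\subseteq_{\vec g}\mathcal R$ for $\forall\vec x.\,\mathcal P(\vec x)\to\mathcal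 R(\vec g(\vec x))$ ($\mathcal P\subseteq\mathcal R$ for $\forall\vec x.\,\mathcal P(\vec x)\to\mathcal R(\vec x)$). The judgement $\Gamma\vdash_{\mathbb E}t:A$, for a set $\mathbb E$ of equations between object terms, is defined by the usual Curry-style natural deduction rules for $\to$, $\forall x$, $\forall X$ (instantiation by arbitrary terms and predicates), together with: * from $t:A[x:=r]$ infer $t:A[x:=s]$, if $r=s$ follows from substitution instances of equations of $\mathbb E$ (in either orientation) by reflexivity, transitivity and compatibility with function symbols; * from $r:\Phi(\mu(\Phi))(\vec t\,)$ infer $\mathsf{in}\,r:\mu(\Phi)(\vec c(\vec t\,))$; from $r:\nu(\Phi)(\vec t\,)$ infer $\mathsf{out}\,r:\Phi(\nu(\Phi))(\vec d(\vec t\,))$; * from $s:\forall X(X\subseteq\mu(\Phi)\to X\subseteq_{\vec f}\mathcal K\to\Phi(X)\subseteq_{\vec f\circ\vec c}\mathcal K)$ and $r:\mu(\Phi)(\vec t\,)$ infer $\mathsf{MRec}\,s\,r:\mathcal K(\vec f(\vec t\,))$; * from $s:\forall X(\nu(\Phi)\subseteq X\to\mathcal K\subseteq_{\vec f}X\to\mathcal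 K\subseteq_{\vec d\circ\vec f}\Phi(X))$ and $r:\mathcal K(\vec t\,)$ infer $\mathsf{MCoRec}\,s\,r:\nu(\Phi)(\vec f(\vec t\,))$. *Semantics.* A model $\mathfrak M=\langle M,\mathcal I\rangle$ consists of a non-empty set $M$, a function $M^n\to M$ for each $n$-ary function symbol and an element of $\mathsf{SAT}_n$ for each $n$-ary predicate symbol. For an assignment $\sigma$ of elements of $M$ to first-order variables and of elements of $\mathsf{SAT}_n$ to $n$-ary second-order variables, $\mathcal I_\sigma$ interprets terms in $M$, $n$-ary predicates in $\mathsf{SAT}_n$ and formulas in $\mathsf{SAT}$: variables by $\sigma$, symbols by $\mathcal I$, compositions of function symbols by compositions, $\mathcal I_\sigma(\lambda\vec x.A)(\vec m)=\mathcal I_{\sigma[\vec x/\vec m]}(A)$, $\mathcal I_\sigma(\mu(\Phi))=\mu(\mathcal I_\sigma(\Phi))$ and $\mathcal I_\sigma(\nu(\Phi))=\nu(\mathcal I_\sigma(\Phi))$ (taken with the interpretations of $\vec c$, $\vec d$), where $\mathcal I_\sigma(\lambda X.\mathcal P)(F)=\mathcal I_{\sigma[X/F]}(\mathcal P)$; application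 by application, $\to$ by $\Rightarrow$, and $\forall x$, $\forall X$ by intersections over $M$ and $\mathsf{SAT}_n$. **Statement.** Let $\mathfrak M$ be a model that satisfies the equations $\mathbb E$, that is, $\mathcal I_\tau(r)=\mathcal I_\tau(s)$ for every equation $r=s$ in $\mathbb E$ and every assignment $\tau$. Let $\sigma$ be an assignment and suppose $\Gamma\vdash_{\mathbb E}t:A$ with $\Gamma=\{x_1:A_1,\dots,x_n:A_n\}$. If $r_i\in\mathcal I_\sigma(A_i)$ for all $1\le i\le n$, then $t[\vec x:=\vec r\,]\in\mathcal I_\sigma(A)$. -/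

import Mathlib

namespace AF2

/-! ## Proof-terms -/

/-- Proof-terms, with de Bruijn indices for the term variables. -/
inductive ProofTerm : Type
  | var (i : ℕ)
  | lam (r : ProofTerm)
  | app (r s : ProofTerm)
  | inn (r : ProofTerm)
  | out (r : ProofTerm)
  | mrec (s r : ProofTerm)
  | mcorec (s r : ProofTerm)

namespace ProofTerm

/-- Extension of a renaming under one binder. -/
def liftRen (ξ : ℕ → ℕ) : ℕ → ℕ
  | 0 => 0
  | i + 1 => ξ i + 1

/-- Renaming of term variables. -/
def rename : ProofTerm → (ℕ → ℕ) → ProofTerm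
  | var i, ξ => var (ξ i)
  | lam r, ξ => lam (r.rename (liftRen ξ))
  | app r s, ξ => app (r.rename ξ) (s.rename ξ)
  | inn r, ξ => inn (r.rename ξ)
  | out r, ξ => out (r.rename ξ)
  | mrec s r, ξ => mrec (s.rename ξ) (r.rename ξ)
  | mcorec s r, ξ => mcorec (s.rename ξ) (r.rename ξ)

/-- All free variables are moved up by one. -/
def shift (r : ProofTerm) : ProofTerm := r.rename Nat.succ

/-- Extension of a simultaneous substitution under one binder. -/
def liftSubst (τ : ℕ → ProofTerm) : ℕ → ProofTerm
  | 0 => var 0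
  | i + 1 => (τ i).shift

/-- Simultaneous capture-avoiding substitution. -/
def subst : ProofTerm → (ℕ → ProofTerm) → ProofTerm
  | var i, τ => τ i
  | lam r, τ => lam (r.subst (liftSubst τ))
  | app r s, τ => app (r.subst τ) (s.subst τ)
  | inn r, τ => inn (r.subst τ)
  | out r, τ => out (r.subst τ)
  | mrec s r, τ => mrec (s.subst τ) (r.subst τ)
  | mcorec s r, τ => mcorec (s.subst τ) (r.subst τ)

/-- The term `r[x := s]` for the body `r` of an abstraction over `x`. -/
def inst (r s : ProofTerm) : ProofTerm :=
  r.subst fun i => match i with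
    | 0 => s
    | j + 1 => var j

/-- The term `t[x₀ := r₀, …, xₙ₋₁ := rₙ₋₁]`; the other variables are left alone. -/
def substTuple (t : ProofTerm) {n : ℕ} (r : Fin n → ProofTerm) : ProofTerm :=
  t.subst fun i => if h : i < n then r ⟨i, h⟩ else var i

/-- The term `λx. x`. -/
def idTerm : ProofTerm := lam (var 0)

/-- `MRec s` without a second argument stands for `λx. MRec s x`. -/
def mrecFun (s : ProofTerm) : ProofTerm := lam (mrec s.shift (var 0))

/-- `MCoRec s` without a second argument stands for `λx. MCoRec s x`. -/
def mcorecFun (s : ProofTerm) : ProofTerm := lam (mcorec s.shift (var 0))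

/-- The reduction axioms: `Contract t t'` says that `t` is a redex and `t'` its contractum. -/
inductive Contract : ProofTerm → ProofTerm → Prop
  | beta (r s : ProofTerm) : Contract (app (lam r) s) (r.inst s)
  | mrec (s t : ProofTerm) :
      Contract (mrec s (inn t)) (app (app (app s idTerm) (mrecFun s)) t)
  | mcorec (s t : ProofTerm) :
      Contract (out (mcorec s t)) (app (app (app s idTerm) (mcorecFun s)) t)

/-- `I`-terms, the terms generated by an introduction rule. -/
inductive IsITerm : ProofTerm → Prop
  | lam (r : ProofTerm) : IsITerm (lam r)
  | inn (r : ProofTerm) : IsITerm (inn r)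
  | mcorec (s r : ProofTerm) : IsITerm (mcorec s r)

/-- Immediate subterms. -/
def ist : ProofTerm → Set ProofTerm
  | var _ => ∅
  | lam r => {r}
  | inn r => {r}
  | out r => {r}
  | app r s => {r, s}
  | mrec s r => {s, r}
  | mcorec s r => {s, r}

/-- Problematic subterms of a redex. -/
def prt : ProofTerm → Set ProofTerm
  | app (lam _) s => {s}
  | _ => ∅

end ProofTerm

open ProofTerm

/-- Evaluation contexts. -/
inductive ECtx : Type
  | hole
  | app (E : ECtx) (s : ProofTerm)
  | out (E : ECtx)
  | mrec (s : ProofTerm) (E : ECtx)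

/-- The term `E[r]`. -/
def ECtx.fill : ECtx → ProofTerm → ProofTerm
  | hole, r => r
  | app E s, r => ProofTerm.app (E.fill r) s
  | out E, r => ProofTerm.out (E.fill r)
  | mrec s E, r => ProofTerm.mrec s (E.fill r)

/-- Immediate subterms of the context `E[•]`, where the hole is regarded as the variable `y`. -/
def ECtx.ist (y : ℕ) (E : ECtx) : Set ProofTerm := (E.fill (var y)).ist

/-- The inductively defined set of strongly normalizing terms.  A weak head reduction step
`E[t] → E[t']` is given by an evaluation context `E` and a contraction of the redex `t`. -/
inductive SN : ProofTerm → Prop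
  | var (x : ℕ) : SN (var x)
  | intro (t : ProofTerm) : IsITerm t → (∀ u ∈ t.ist, SN u) → SN t
  | elim (E E' : ECtx) (x y : ℕ) :
      SN (E.fill (ProofTerm.var x)) → (∀ u ∈ E'.ist y, SN u) →
        SN (E'.fill (E.fill (ProofTerm.var x)))
  | whd (E : ECtx) (t t' : ProofTerm) :
      SN (E.fill t') → Contract t t' → (∀ u ∈ t.prt, SN u) → SN (E.fill t)

/-! ## Saturated sets -/

/-- Saturated sets of proof-terms. -/
structure IsSaturated (S : Set ProofTerm) : Prop where
  sn : ∀ t ∈ S, SN t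
  neutral : ∀ (E : ECtx) (x : ℕ), SN (E.fill (var x)) → E.fill (var x) ∈ S
  whd : ∀ (E : ECtx) (t t' : ProofTerm),
    E.fill t' ∈ S → Contract t t' → (∀ u ∈ t.prt, SN u) → E.fill t ∈ S

/-- The type of all saturated sets. -/
def SAT : Type := {S : Set ProofTerm // IsSaturated S}

namespace SAT

instance : SetLike SAT ProofTerm where
  coe S := S.1
  coe_injective := Subtype.val_injective

/-- Inclusion. -/
instance : PartialOrder SAT := PartialOrder.ofSetLike SAT ProofTerm

/-- Intersection; the empty intersection is the largest saturated set, `SN`. -/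
instance : InfSet SAT where
  sInf 𝒮 := ⟨{t | SN t ∧ ∀ S ∈ 𝒮, t ∈ S},
    { sn := fun _ h => h.1
      neutral := fun E x h => ⟨h, fun S _ => S.2.neutral E x h⟩
      whd := fun E t t' h c p =>
        ⟨SN.whd E t t' h.1 c p, fun S hS => S.2.whd E t t' (h.2 S hS) c p⟩ }⟩

/-- The complete lattice of saturated sets, with inclusion and intersection. -/
instance : CompleteLattice SAT :=
  completeLatticeOfInf SAT fun _ =>
    ⟨fun S hS _ ht => ht.2 S hS, fun T hT t ht => ⟨T.2.sn t ht, fun _ hS => hT hS ht⟩⟩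

/-- The saturated closure of a set of terms. -/
def cl (X : Set ProofTerm) : SAT := sInf {N : SAT | X ∩ {t | SN t} ⊆ (N : Set ProofTerm)}

theorem cl_mono {X Y : Set ProofTerm} (h : X ⊆ Y) : cl X ≤ cl Y :=
  sInf_le_sInf fun _ hN => (Set.inter_subset_inter_left _ h).trans hN

/-- The implication `S ⇒ T` of saturated sets. -/
def imp (S T : SAT) : SAT := cl {r | ∀ s ∈ S, app r s ∈ T}

end SAT

/-- The complete lattice of `SAT`-valued `n`-ary functions, with the pointwise structure. -/
abbrev SATFun (M : Type*) (n : ℕ) : Type _ := (Fin n → M) → SAT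

section FixedPoints

variable {M : Type*} {n : ℕ}

/-- `in r` with `r ∈ Φ(F)(t⃗)`, as an element over the tuple `c⃗(t⃗)`. -/
def muIntro (c : Fin n → M → M) (Φ : SATFun M n → SATFun M n) (F : SATFun M n)
    (u : Fin n → M) : Set ProofTerm :=
  {q | ∃ (t : Fin n → M) (r : ProofTerm),
    (fun i => c i (t i)) = u ∧ r ∈ Φ F t ∧ q = inn r}

/-- The saturated closure of the upper monotonization of `muIntro`. -/
def muStep (c : Fin n → M → M) (Φ : SATFun M n → SATFun M n) : SATFun M n →o SATFun M n where
  toFun F u := SAT.cl (⋃ (F' : SATFun M n) (_ : F' ≤ F), muIntro c Φ F' u)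
  monotone' _ _ h _ := SAT.cl_mono
    (Set.iUnion_mono fun _ => Set.iUnion_subset fun h' =>
      Set.subset_iUnion_of_subset (h'.trans h) subset_rfl)

/-- The inductive construction `μ(Φ)` with constructors `c⃗`, for an arbitrary operator `Φ`. -/
def muSAT (c : Fin n → M → M) (Φ : SATFun M n → SATFun M n) : SATFun M n :=
  OrderHom.lfp (muStep c Φ)

/-- The strongly normalizing terms `r` with `out r ∈ Φ(F)(d⃗(t⃗))`. -/
def nuElim (d : Fin n → M → M) (Φ : SATFun M n → SATFun M n) (F : SATFun M n)
    (t : Fin n → M) : Set ProofTerm :=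
  {r | SN r ∧ out r ∈ Φ F (fun i => d i (t i))}

/-- The saturated closure of the lower monotonization of `nuElim`. -/
def nuStep (d : Fin n → M → M) (Φ : SATFun M n → SATFun M n) : SATFun M n →o SATFun M n where
  toFun F t := SAT.cl (⋂ (F' : SATFun M n) (_ : F ≤ F'), nuElim d Φ F' t)
  monotone' _ _ h _ := SAT.cl_mono
    (Set.iInter_mono fun _ => Set.subset_iInter fun h' =>
      Set.iInter_subset_of_subset (h.trans h') subset_rfl)

/-- The coinductive construction `ν(Φ)` with destructors `d⃗`, for an arbitrary operator `Φ`. -/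
def nuSAT (d : Fin n → M → M) (Φ : SATFun M n → SATFun M n) : SATFun M n :=
  OrderHom.gfp (nuStep d Φ)

end FixedPoints

/-! ## Syntax of the logic -/

open FirstOrder

/-- Function symbols: those of the signature, closed under composition of unary symbols. -/
inductive FunSym (L : Language) : ℕ → Type _
  | base {n : ℕ} (f : L.Functions n) : FunSym L n
  | comp (f g : FunSym L 1) : FunSym L 1

/-- The language of the object terms. -/
abbrev termLang (L : Language) : Language := ⟨FunSym L, fun _ => Empty⟩

/-- Object terms with variables in `V`. -/
abbrev OTerm (L : Language) (V : Type) : Type _ := (termLang L).Term V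

/-- The term `f(t)` for a unary function symbol `f`. -/
def ap1 {L : Language} {V : Type} (f : FunSym L 1) (t : OTerm L V) : OTerm L V :=
  Language.Term.func (L := termLang L) f ![t]

/-- Second-order variables of arity `n` in a scope, which lists the arities of the variables. -/
inductive SVar : List ℕ → ℕ → Type
  | zero {n : ℕ} {Δ : List ℕ} : SVar (n :: Δ) n
  | succ {m n : ℕ} {Δ : List ℕ} : SVar Δ n → SVar (m :: Δ) n

mutual

/-- Predicates of a given arity, whose free variables are the `k` first-order variables and the
second-order variables of the scope `Δ`.  A predicate transformer is a closed `Φ = λX. 𝒫`,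
that is, a predicate in which only `X` may be free.  A (co)inductive predicate carries its fixed
tuple of constructors (destructors). -/
inductive Pred (L : Language) : ℕ → List ℕ → ℕ → Type _
  | var {k : ℕ} {Δ : List ℕ} {n : ℕ} (X : SVar Δ n) : Pred L k Δ n
  | sym {k : ℕ} {Δ : List ℕ} {n : ℕ} (P : L.Relations n) : Pred L k Δ n
  | compr {k : ℕ} {Δ : List ℕ} {n : ℕ} (A : Form L (k + n) Δ) : Pred L k Δ n
  | mu {k : ℕ} {Δ : List ℕ} {n : ℕ} (Φ : Pred L 0 [n] n) (c : Fin n → FunSym L 1) : Pred L k Δ n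
  | nu {k : ℕ} {Δ : List ℕ} {n : ℕ} (Φ : Pred L 0 [n] n) (d : Fin n → FunSym L 1) : Pred L k Δ n

/-- Formulas whose free variables are the `k` first-order variables and the second-order
variables of the scope `Δ`. -/
inductive Form (L : Language) : ℕ → List ℕ → Type _
  | app {k : ℕ} {Δ : List ℕ} {n : ℕ} (P : Pred L k Δ n) (t : Fin n → OTerm L (Fin k)) : Form L k Δ
  | imp {k : ℕ} {Δ : List ℕ} (A B : Form L k Δ) : Form L k Δ
  | all {k : ℕ} {Δ : List ℕ} (A : Form L (k + 1) Δ) : Form L k Δ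
  | all2 {k : ℕ} {Δ : List ℕ} (n : ℕ) (A : Form L k (n :: Δ)) : Form L k Δ

end

/-! ### Substitution -/

section Substitution

variable {L : Language}

/-- Extension of a first-order substitution under `n` binders. -/
def liftFO {k l : ℕ} (n : ℕ) (θ : Fin k → OTerm L (Fin l)) : Fin (k + n) → OTerm L (Fin (l + n)) :=
  Fin.addCases (fun i => (θ i).relabel (Fin.castAdd n))
    (fun j => Language.Term.var (Fin.natAdd l j))

mutual

/-- Simultaneous substitution of terms for first-order variables in a predicate. -/
def Pred.substFO {k l : ℕ} {Δ : List ℕ} {n : ℕ} :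
    Pred L k Δ n → (Fin k → OTerm L (Fin l)) → Pred L l Δ n
  | .var X, _ => .var X
  | .sym P, _ => .sym P
  | .compr A, θ => .compr (A.substFO (liftFO n θ))
  | .mu Φ c, _ => .mu Φ c
  | .nu Φ d, _ => .nu Φ d

/-- Simultaneous substitution of terms for first-order variables in a formula. -/
def Form.substFO {k l : ℕ} {Δ : List ℕ} :
    Form L k Δ → (Fin k → OTerm L (Fin l)) → Form L l Δ
  | .app P t, θ => .app (P.substFO θ) (fun i => (t i).subst θ)
  | .imp A B, θ => .imp (A.substFO θ) (B.substFO θ)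
  | .all A, θ => .all (A.substFO (liftFO 1 θ))
  | .all2 m A, θ => .all2 m (A.substFO θ)

end

/-- Weakening by `n` new first-order variables. -/
def Pred.weakFO {k : ℕ} {Δ : List ℕ} {m : ℕ} (n : ℕ) (P : Pred L k Δ m) : Pred L (k + n) Δ m :=
  P.substFO fun i => Language.Term.var (Fin.castAdd n i)

/-- Weakening by `n` new first-order variables. -/
def Form.weakFO {k : ℕ} {Δ : List ℕ} (n : ℕ) (A : Form L k Δ) : Form L (k + n) Δ :=
  A.substFO fun i => Language.Term.var (Fin.castAdd n i)

/-- `A[x⃗ := t⃗]` for the last `n` first-order variables `x⃗`. -/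
def Form.instFO {k n : ℕ} {Δ : List ℕ} (A : Form L (k + n) Δ) (t : Fin n → OTerm L (Fin k)) :
    Form L k Δ :=
  A.substFO (Fin.addCases (fun i => Language.Term.var i) t)

/-- Extension of a second-order renaming under one binder. -/
def liftRenSO {Δ Δ' : List ℕ} {m : ℕ} (ξ : ∀ n, SVar Δ n → SVar Δ' n) :
    ∀ n, SVar (m :: Δ) n → SVar (m :: Δ') n
  | _, .zero => .zero
  | n, .succ X => .succ (ξ n X)

mutual

/-- Renaming of second-order variables in a predicate. -/
def Pred.renSO {k : ℕ} {Δ Δ' : List ℕ} {n : ℕ} :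
    Pred L k Δ n → (∀ n, SVar Δ n → SVar Δ' n) → Pred L k Δ' n
  | .var X, ξ => .var (ξ _ X)
  | .sym P, _ => .sym P
  | .compr A, ξ => .compr (A.renSO ξ)
  | .mu Φ c, _ => .mu Φ c
  | .nu Φ d, _ => .nu Φ d

/-- Renaming of second-order variables in a formula. -/
def Form.renSO {k : ℕ} {Δ Δ' : List ℕ} :
    Form L k Δ → (∀ n, SVar Δ n → SVar Δ' n) → Form L k Δ'
  | .app P t, ξ => .app (P.renSO ξ) t
  | .imp A B, ξ => .imp (A.renSO ξ) (B.renSO ξ)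
  | .all A, ξ => .all (A.renSO ξ)
  | .all2 _ A, ξ => .all2 _ (A.renSO (liftRenSO ξ))

end

/-- Weakening by a new second-order variable. -/
def Pred.weakSO {k : ℕ} {Δ : List ℕ} {n : ℕ} (m : ℕ) (P : Pred L k Δ n) : Pred L k (m :: Δ) n :=
  P.renSO fun _ => SVar.succ

/-- Weakening by a new second-order variable. -/
def Form.weakSO {k : ℕ} {Δ : List ℕ} (m : ℕ) (A : Form L k Δ) : Form L k (m :: Δ) :=
  A.renSO fun _ => SVar.succ

/-- Extension of a second-order substitution under a second-order binder. -/
def liftSO {k : ℕ} {Δ Δ' : List ℕ} {m : ℕ} (Θ : ∀ n, SVar Δ n → Pred L k Δ' n) :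
    ∀ n, SVar (m :: Δ) n → Pred L k (m :: Δ') n
  | _, .zero => .var .zero
  | n, .succ X => (Θ n X).weakSO m

mutual

/-- Simultaneous substitution of predicates for second-order variables in a predicate. -/
def Pred.substSO {k : ℕ} {Δ Δ' : List ℕ} {n : ℕ} :
    Pred L k Δ n → (∀ n, SVar Δ n → Pred L k Δ' n) → Pred L k Δ' n
  | .var X, Θ => Θ _ X
  | .sym P, _ => .sym P
  | .compr A, Θ => .compr (A.substSO fun m X => (Θ m X).weakFO n)
  | .mu Φ c, _ => .mu Φ c
  | .nu Φ d, _ => .nu Φ d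

/-- Simultaneous substitution of predicates for second-order variables in a formula. -/
def Form.substSO {k : ℕ} {Δ Δ' : List ℕ} :
    Form L k Δ → (∀ n, SVar Δ n → Pred L k Δ' n) → Form L k Δ'
  | .app P t, Θ => .app (P.substSO Θ) t
  | .imp A B, Θ => .imp (A.substSO Θ) (B.substSO Θ)
  | .all A, Θ => .all (A.substSO fun m X => (Θ m X).weakFO 1)
  | .all2 _ A, Θ => .all2 _ (A.substSO (liftSO Θ))

end

/-- The second-order substitution `[X := R]` for the most recent variable `X`. -/
def oneSO {k : ℕ} {Δ : List ℕ} {m : ℕ} (R : Pred L k Δ m) :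
    ∀ n, SVar (m :: Δ) n → Pred L k Δ n
  | _, .zero => R
  | _, .succ X => .var X

/-- `A[X := R]`. -/
def Form.instSO {k : ℕ} {Δ : List ℕ} {m : ℕ} (A : Form L k (m :: Δ)) (R : Pred L k Δ m) :
    Form L k Δ :=
  A.substSO (oneSO R)

/-- The application `Φ(R) = 𝒫[X := R]` of a predicate transformer `Φ = λX. 𝒫`. -/
def Pred.transApp {k : ℕ} {Δ : List ℕ} {n : ℕ} (Φ : Pred L 0 [n] n) (R : Pred L k Δ n) :
    Pred L k Δ n :=
  ((Φ.substFO (l := k) Fin.elim0).renSO (Δ' := n :: Δ)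
    fun _ X => match X with | .zero => .zero).substSO (oneSO R)

end Substitution

/-! ### Derivations -/

section Derivations

variable {L : Language}

/-- `∀x₁ … ∀xₙ. A`. -/
def Form.alls {k : ℕ} {Δ : List ℕ} : (n : ℕ) → Form L (k + n) Δ → Form L k Δ
  | 0, A => A
  | n + 1, A => Form.alls n (.all A)

/-- The formula `∀x⃗. P(x⃗) → R(g⃗(x⃗))`. -/
def subAlong {k : ℕ} {Δ : List ℕ} {n : ℕ} (g : Fin n → FunSym L 1) (P R : Pred L k Δ n) :
    Form L k Δ :=
  Form.alls n (.imp
    (.app (P.weakFO n) fun i => Language.Term.var (Fin.natAdd k i))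
    (.app (R.weakFO n) fun i => ap1 (g i) (Language.Term.var (Fin.natAdd k i))))

/-- The formula `∀x⃗. P(x⃗) → R(x⃗)`. -/
def sub {k : ℕ} {Δ : List ℕ} {n : ℕ} (P R : Pred L k Δ n) : Form L k Δ :=
  Form.alls n (.imp
    (.app (P.weakFO n) fun i => Language.Term.var (Fin.natAdd k i))
    (.app (R.weakFO n) fun i => Language.Term.var (Fin.natAdd k i)))

/-- An equation `r = s` between object terms with variables `x₀, x₁, …`. -/
abbrev Equation (L : Language) : Type _ := OTerm L ℕ × OTerm L ℕ

/-- `EqDer E r s` is the derivability of `r = s` from the equations `E`, by instances of the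
equations (in both orientations), reflexivity, transitivity and compatibility with functions.
The composite symbols come with their defining equations `(f ∘ g)(x) = f(g(x))`. -/
inductive EqDer (E : Set (Equation L)) {V : Type} : OTerm L V → OTerm L V → Prop
  | inst (r s : OTerm L ℕ) (t : ℕ → OTerm L V) : (r, s) ∈ E → EqDer E (r.subst t) (s.subst t)
  | inst' (r s : OTerm L ℕ) (t : ℕ → OTerm L V) : (r, s) ∈ E → EqDer E (s.subst t) (r.subst t)
  | comp (f g : FunSym L 1) (t : OTerm L V) : EqDer E (ap1 (.comp f g) t) (ap1 f (ap1 g t))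
  | comp' (f g : FunSym L 1) (t : OTerm L V) : EqDer E (ap1 f (ap1 g t)) (ap1 (.comp f g) t)
  | refl (r : OTerm L V) : EqDer E r r
  | trans (r s t : OTerm L V) : EqDer E r s → EqDer E s t → EqDer E r t
  | func {n : ℕ} (f : FunSym L n) (r s : Fin n → OTerm L V) : (∀ i, EqDer E (r i) (s i)) →
      EqDer E (Language.Term.func (L := termLang L) f r) (Language.Term.func (L := termLang L) f s)

mutual

/-- Equality of predicates up to the identification of `(λx⃗. A)(t⃗)` with `A[x⃗ := t⃗]`. -/
inductive PredConv : ∀ {k : ℕ} {Δ : List ℕ} {n : ℕ}, Pred L k Δ n → Pred L k Δ n → Prop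
  | refl {k : ℕ} {Δ : List ℕ} {n : ℕ} (P : Pred L k Δ n) : PredConv P P
  | compr {k : ℕ} {Δ : List ℕ} {n : ℕ} {A B : Form L (k + n) Δ} :
      FormConv A B → PredConv (.compr A : Pred L k Δ n) (.compr B)
  | mu {k : ℕ} {Δ : List ℕ} {n : ℕ} {Φ Ψ : Pred L 0 [n] n} (c : Fin n → FunSym L 1) :
      PredConv Φ Ψ → PredConv (.mu Φ c : Pred L k Δ n) (.mu Ψ c)
  | nu {k : ℕ} {Δ : List ℕ} {n : ℕ} {Φ Ψ : Pred L 0 [n] n} (d : Fin n → FunSym L 1) :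
      PredConv Φ Ψ → PredConv (.nu Φ d : Pred L k Δ n) (.nu Ψ d)

/-- Equality of formulas up to the identification of `(λx⃗. A)(t⃗)` with `A[x⃗ := t⃗]`. -/
inductive FormConv : ∀ {k : ℕ} {Δ : List ℕ}, Form L k Δ → Form L k Δ → Prop
  | beta {k : ℕ} {Δ : List ℕ} {n : ℕ} (A : Form L (k + n) Δ) (t : Fin n → OTerm L (Fin k)) :
      FormConv (.app (.compr A) t) (A.instFO t)
  | refl {k : ℕ} {Δ : List ℕ} (A : Form L k Δ) : FormConv A A
  | symm {k : ℕ} {Δ : List ℕ} {A B : Form L k Δ} : FormConv A B → FormConv B A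
  | trans {k : ℕ} {Δ : List ℕ} {A B C : Form L k Δ} :
      FormConv A B → FormConv B C → FormConv A C
  | app {k : ℕ} {Δ : List ℕ} {n : ℕ} {P Q : Pred L k Δ n} (t : Fin n → OTerm L (Fin k)) :
      PredConv P Q → FormConv (.app P t) (.app Q t)
  | imp {k : ℕ} {Δ : List ℕ} {A A' B B' : Form L k Δ} :
      FormConv A A' → FormConv B B' → FormConv (.imp A B) (.imp A' B')
  | all {k : ℕ} {Δ : List ℕ} {A B : Form L (k + 1) Δ} :
      FormConv A B → FormConv (.all A) (.all B)
  | all2 {k : ℕ} {Δ : List ℕ} {n : ℕ} {A B : Form L k (n :: Δ)} :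
      FormConv A B → FormConv (.all2 n A) (.all2 n B)

end

/-- The derivation relation `Γ ⊢_E t : A`.  The `i`-th entry of the list `Γ` is the formula that
annotates the proof-term variable with de Bruijn index `i`. -/
inductive Derives (E : Set (Equation L)) :
    ∀ {k : ℕ} {Δ : List ℕ}, List (Form L k Δ) → ProofTerm → Form L k Δ → Prop
  | var {k : ℕ} {Δ : List ℕ} {Γ : List (Form L k Δ)} (i : Fin Γ.length) :
      Derives E Γ (.var i) (Γ.get i)
  | impI {k : ℕ} {Δ : List ℕ} {Γ : List (Form L k Δ)} {r : ProofTerm} {A B : Form L k Δ} :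
      Derives E (A :: Γ) r B → Derives E Γ (.lam r) (.imp A B)
  | impE {k : ℕ} {Δ : List ℕ} {Γ : List (Form L k Δ)} {r s : ProofTerm} {A B : Form L k Δ} :
      Derives E Γ r (.imp A B) → Derives E Γ s A → Derives E Γ (.app r s) B
  | allI {k : ℕ} {Δ : List ℕ} {Γ : List (Form L k Δ)} {t : ProofTerm} {A : Form L (k + 1) Δ} :
      Derives E (Γ.map (Form.weakFO 1)) t A → Derives E Γ t (.all A)
  | allE {k : ℕ} {Δ : List ℕ} {Γ : List (Form L k Δ)} {t : ProofTerm} {A : Form L (k + 1) Δ}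
      (r : OTerm L (Fin k)) : Derives E Γ t (.all A) → Derives E Γ t (A.instFO ![r])
  | all2I {k : ℕ} {Δ : List ℕ} {n : ℕ} {Γ : List (Form L k Δ)} {t : ProofTerm}
      {A : Form L k (n :: Δ)} :
      Derives E (Γ.map (Form.weakSO n)) t A → Derives E Γ t (.all2 n A)
  | all2E {k : ℕ} {Δ : List ℕ} {n : ℕ} {Γ : List (Form L k Δ)} {t : ProofTerm}
      {A : Form L k (n :: Δ)} (P : Pred L k Δ n) :
      Derives E Γ t (.all2 n A) → Derives E Γ t (A.instSO P)
  | eq {k : ℕ} {Δ : List ℕ} {Γ : List (Form L k Δ)} {t : ProofTerm} {A : Form L (k + 1) Δ}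
      {r s : OTerm L (Fin k)} :
      Derives E Γ t (A.instFO ![r]) → EqDer E r s → Derives E Γ t (A.instFO ![s])
  | conv {k : ℕ} {Δ : List ℕ} {Γ : List (Form L k Δ)} {t : ProofTerm} {A B : Form L k Δ} :
      Derives E Γ t A → FormConv A B → Derives E Γ t B
  | muI {k : ℕ} {Δ : List ℕ} {n : ℕ} {Γ : List (Form L k Δ)} {r : ProofTerm}
      {Φ : Pred L 0 [n] n} {c : Fin n → FunSym L 1} {t : Fin n → OTerm L (Fin k)} :
      Derives E Γ r (.app (Φ.transApp (.mu Φ c)) t) →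
      Derives E Γ (.inn r) (.app (.mu Φ c) fun i => ap1 (c i) (t i))
  | nuE {k : ℕ} {Δ : List ℕ} {n : ℕ} {Γ : List (Form L k Δ)} {r : ProofTerm}
      {Φ : Pred L 0 [n] n} {d : Fin n → FunSym L 1} {t : Fin n → OTerm L (Fin k)} :
      Derives E Γ r (.app (.nu Φ d) t) →
      Derives E Γ (.out r) (.app (Φ.transApp (.nu Φ d)) fun i => ap1 (d i) (t i))
  | muE {k : ℕ} {Δ : List ℕ} {n : ℕ} {Γ : List (Form L k Δ)} {s r : ProofTerm}
      {Φ : Pred L 0 [n] n} {c f : Fin n → FunSym L 1} {K : Pred L k Δ n}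
      {t : Fin n → OTerm L (Fin k)} :
      Derives E Γ s (.all2 n (.imp (sub (.var .zero) (.mu Φ c))
        (.imp (subAlong f (.var .zero) (K.weakSO n))
          (subAlong (fun i => .comp (f i) (c i)) (Φ.transApp (.var .zero)) (K.weakSO n))))) →
      Derives E Γ r (.app (.mu Φ c) t) →
      Derives E Γ (.mrec s r) (.app K fun i => ap1 (f i) (t i))
  | nuI {k : ℕ} {Δ : List ℕ} {n : ℕ} {Γ : List (Form L k Δ)} {s r : ProofTerm}
      {Φ : Pred L 0 [n] n} {d f : Fin n → FunSym L 1} {K : Pred L k Δ n}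
      {t : Fin n → OTerm L (Fin k)} :
      Derives E Γ s (.all2 n (.imp (sub (.nu Φ d) (.var .zero))
        (.imp (subAlong f (K.weakSO n) (.var .zero))
          (subAlong (fun i => .comp (d i) (f i)) (K.weakSO n) (Φ.transApp (.var .zero)))))) →
      Derives E Γ r (.app K t) →
      Derives E Γ (.mcorec s r) (.app (.nu Φ d) fun i => ap1 (f i) (t i))

end Derivations

/-! ## Semantics -/

/-- A model on the universe `M`: function symbols are interpreted by functions on `M`, predicate
symbols by `SAT`-valued functions. -/
structure Model (L : Language) (M : Type*) where
  fn : ∀ {n : ℕ}, L.Functions n → (Fin n → M) → M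
  rel : ∀ {n : ℕ}, L.Relations n → SATFun M n

section Semantics

variable {L : Language} {M : Type*}

/-- Interpretation of function symbols; `f ∘ g` is interpreted by the composition. -/
def Model.fnSym (𝔐 : Model L M) : ∀ {n : ℕ}, FunSym L n → (Fin n → M) → M
  | _, .base f, v => 𝔐.fn f v
  | _, .comp f g, v => 𝔐.fnSym f ![𝔐.fnSym g v]

/-- The functions of the model as a first-order structure. -/
@[reducible] def Model.str (𝔐 : Model L M) : (termLang L).Structure M where
  funMap f v := 𝔐.fnSym f v
  RelMap R _ := nomatch R

/-- Interpretation of object terms. -/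
def Model.term (𝔐 : Model L M) {V : Type} (v : V → M) (t : OTerm L V) : M :=
  letI := 𝔐.str
  t.realize v

/-- The assignment `v` satisfies all the equations in `E`. -/
def Model.Satisfies (𝔐 : Model L M) (v : ℕ → M) (E : Set (Equation L)) : Prop :=
  ∀ r s : OTerm L ℕ, (r, s) ∈ E → 𝔐.term v r = 𝔐.term v s

/-- Assignments of `SAT`-valued functions to the second-order variables of a scope. -/
abbrev SOAssign (M : Type*) (Δ : List ℕ) : Type _ := ∀ n : ℕ, SVar Δ n → SATFun M n

/-- The assignment on the empty scope. -/
def SOAssign.empty : SOAssign M [] := fun _ X => nomatch X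

/-- The modified assignment `σ[X/G]`, for a new variable `X`. -/
def SOAssign.push {Δ : List ℕ} {m : ℕ} (σ : SOAssign M Δ) (G : SATFun M m) : SOAssign M (m :: Δ)
  | _, .zero => G
  | n, .succ X => σ n X

/-- Interpretations of predicates, as functions of the assignment. -/
abbrev PredDen (M : Type*) (k : ℕ) (Δ : List ℕ) (n : ℕ) : Type _ :=
  (Fin k → M) → SOAssign M Δ → SATFun M n

/-- Interpretations of formulas, as functions of the assignment. -/
abbrev FormDen (M : Type*) (k : ℕ) (Δ : List ℕ) : Type _ :=
  (Fin k → M) → SOAssign M Δ → SAT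

mutual

/-- Interpretation of predicates under the assignment given by `v` and `σ`. -/
def Pred.interp (𝔐 : Model L M) {k : ℕ} {Δ : List ℕ} {n : ℕ} : Pred L k Δ n → PredDen M k Δ n
  | .var X => fun _ σ => σ _ X
  | .sym P => fun _ _ => 𝔐.rel P
  | .compr A => fun v σ m => A.interp 𝔐 (Fin.append v m) σ
  | .mu Φ c => fun _ _ => muSAT (fun i x => 𝔐.fnSym (c i) ![x])
      (fun F => Φ.interp 𝔐 Fin.elim0 (SOAssign.empty.push F))
  | .nu Φ d => fun _ _ => nuSAT (fun i x => 𝔐.fnSym (d i) ![x])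
      (fun F => Φ.interp 𝔐 Fin.elim0 (SOAssign.empty.push F))

/-- Interpretation of formulas under the assignment given by `v` and `σ`. -/
def Form.interp (𝔐 : Model L M) {k : ℕ} {Δ : List ℕ} : Form L k Δ → FormDen M k Δ
  | .app P t => fun v σ => P.interp 𝔐 v σ (fun i => 𝔐.term v (t i))
  | .imp A B => fun v σ => SAT.imp (A.interp 𝔐 v σ) (B.interp 𝔐 v σ)
  | .all A => fun v σ => ⨅ m : M, A.interp 𝔐 (Fin.append v ![m]) σ
  | .all2 n A => fun v σ => ⨅ G : SATFun M n, A.interp 𝔐 v (σ.push G)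

end

end Semantics

end AF2

namespace AF2

/-! ## Renaming and substitution of proof-terms -/

namespace ProofTerm

theorem liftRen_comp (ξ ζ : ℕ → ℕ) :
    (fun i => liftRen ζ (liftRen ξ i)) = liftRen fun i => ζ (ξ i) := by
  funext i; cases i <;> rfl

theorem rename_rename (r : ProofTerm) (ξ ζ : ℕ → ℕ) :
    (r.rename ξ).rename ζ = r.rename fun i => ζ (ξ i) := by
  induction r generalizing ξ ζ <;> simp_all [rename, liftRen_comp]

theorem shift_rename (r : ProofTerm) (ξ : ℕ → ℕ) :
    r.shift.rename (liftRen ξ) = (r.rename ξ).shift := by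
  simp [shift, rename_rename, liftRen]

theorem liftSubst_rename (τ : ℕ → ProofTerm) (ξ : ℕ → ℕ) :
    (fun i => (liftSubst τ i).rename (liftRen ξ)) = liftSubst fun i => (τ i).rename ξ := by
  funext i; cases i <;> simp [liftSubst, rename, liftRen, shift_rename]

theorem subst_rename (r : ProofTerm) (τ : ℕ → ProofTerm) (ξ : ℕ → ℕ) :
    (r.subst τ).rename ξ = r.subst fun i => (τ i).rename ξ := by
  induction r generalizing τ ξ <;> simp_all [rename, subst, liftSubst_rename]

theorem liftSubst_liftRen (ξ : ℕ → ℕ) (τ : ℕ → ProofTerm) :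
    (fun i => liftSubst τ (liftRen ξ i)) = liftSubst fun i => τ (ξ i) := by
  funext i; cases i <;> rfl

theorem rename_subst (r : ProofTerm) (ξ : ℕ → ℕ) (τ : ℕ → ProofTerm) :
    (r.rename ξ).subst τ = r.subst fun i => τ (ξ i) := by
  induction r generalizing ξ τ <;> simp_all [rename, subst, liftSubst_liftRen]

theorem liftSubst_liftSubst (τ θ : ℕ → ProofTerm) :
    (fun i => (liftSubst τ i).subst (liftSubst θ)) = liftSubst fun i => (τ i).subst θ := by
  funext i
  cases i <;> simp [liftSubst, subst, shift, rename_subst, subst_rename]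

theorem subst_subst (r : ProofTerm) (τ θ : ℕ → ProofTerm) :
    (r.subst τ).subst θ = r.subst fun i => (τ i).subst θ := by
  induction r generalizing τ θ <;> simp_all [subst, liftSubst_liftSubst]

theorem liftSubst_var : liftSubst var = var := by
  funext i; cases i <;> rfl

theorem subst_var (r : ProofTerm) : r.subst var = r := by
  induction r <;> simp_all [subst, liftSubst_var]

theorem rename_eq_subst (r : ProofTerm) (ξ : ℕ → ℕ) :
    r.rename ξ = r.subst fun i => var (ξ i) := by
  rw [← subst_var (r.rename ξ), rename_subst]

/-- Extension of a substitution by a term for the variable `0`. -/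
def consSubst (s : ProofTerm) (τ : ℕ → ProofTerm) : ℕ → ProofTerm
  | 0 => s
  | i + 1 => τ i

theorem inst_eq (r s : ProofTerm) : r.inst s = r.subst (consSubst s var) := by
  unfold inst
  congr 1

theorem shift_subst_consSubst (r s : ProofTerm) (τ : ℕ → ProofTerm) :
    r.shift.subst (consSubst s τ) = r.subst τ := by
  simp [shift, rename_subst, consSubst]

theorem subst_liftSubst_inst (r s : ProofTerm) (τ : ℕ → ProofTerm) :
    (r.subst (liftSubst τ)).inst s = r.subst (consSubst s τ) := by
  rw [inst_eq, subst_subst]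
  congr 1
  funext i
  cases i with
  | zero => rfl
  | succ i => exact (shift_subst_consSubst _ _ _).trans (subst_var _)

theorem inst_rename (r s : ProofTerm) (ξ : ℕ → ℕ) :
    (r.inst s).rename ξ = (r.rename (liftRen ξ)).inst (s.rename ξ) := by
  rw [inst_eq, inst_eq, subst_rename, rename_subst]
  congr 1
  funext i
  cases i <;> rfl

theorem mrecFun_rename (s : ProofTerm) (ξ : ℕ → ℕ) :
    (mrecFun s).rename ξ = mrecFun (s.rename ξ) := by
  simp [mrecFun, rename, shift_rename, liftRen]

theorem mcorecFun_rename (s : ProofTerm) (ξ : ℕ → ℕ) :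
    (mcorecFun s).rename ξ = mcorecFun (s.rename ξ) := by
  simp [mcorecFun, rename, shift_rename, liftRen]

theorem liftRen_surjective {ξ : ℕ → ℕ} (h : ξ.Surjective) : (liftRen ξ).Surjective
  | 0 => ⟨0, rfl⟩
  | i + 1 => let ⟨j, hj⟩ := h i; ⟨j + 1, congrArg (· + 1) hj⟩

theorem exists_rename_mem_ist {r u : ProofTerm} (hu : u ∈ r.ist) {ξ : ℕ → ℕ}
    (hξ : ξ.Surjective) :
    ∃ ζ : ℕ → ℕ, ζ.Surjective ∧ u.rename ζ ∈ (r.rename ξ).ist := by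
  cases r <;> simp only [ist, Set.mem_insert_iff, Set.mem_singleton_iff, Set.mem_empty_iff_false]
    at hu
  case lam => exact ⟨_, liftRen_surjective hξ, by simp [hu, rename, ist]⟩
  all_goals exact ⟨ξ, hξ, by rcases hu with rfl | rfl <;> simp [rename, ist]⟩

theorem IsITerm.of_rename {r : ProofTerm} {ξ : ℕ → ℕ} (h : IsITerm (r.rename ξ)) :
    IsITerm r := by
  cases r <;> first | constructor | cases h

theorem Contract.of_rename {t u' : ProofTerm} {ξ : ℕ → ℕ} (h : Contract (t.rename ξ) u') :
    ∃ t', Contract t t' ∧ t'.rename ξ = u' ∧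
      ∀ u ∈ t.prt, u.rename ξ ∈ (t.rename ξ).prt := by
  generalize hu : t.rename ξ = w at h
  cases h with
  | beta r s =>
    cases t with
    | app a b =>
      cases a <;> simp only [rename, app.injEq, reduceCtorEq, false_and] at hu
      obtain ⟨h1, rfl⟩ := hu
      cases h1
      exact ⟨_, .beta _ _, inst_rename _ _ _, by simp [prt]⟩
    | _ => cases hu
  | mrec s r =>
    cases t with
    | mrec a b =>
      cases b <;> simp only [rename, ProofTerm.mrec.injEq, reduceCtorEq, and_false] at hu
      obtain ⟨rfl, h1⟩ := hu
      cases h1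
      exact ⟨_, .mrec _ _, by simp [rename, mrecFun_rename, idTerm, liftRen], by simp [prt]⟩
    | _ => cases hu
  | mcorec s r =>
    cases t with
    | out b =>
      cases b <;> simp only [rename, out.injEq, reduceCtorEq] at hu
      cases hu
      exact ⟨_, .mcorec _ _, by simp [rename, mcorecFun_rename, idTerm, liftRen], by simp [prt]⟩
    | _ => cases hu

end ProofTerm

open ProofTerm

/-- Renaming of term variables in an evaluation context. -/
def ECtx.rename : ECtx → (ℕ → ℕ) → ECtx
  | hole, _ => hole
  | app E s, ξ => app (E.rename ξ) (s.rename ξ)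
  | out E, ξ => out (E.rename ξ)
  | mrec s E, ξ => mrec (s.rename ξ) (E.rename ξ)

theorem ECtx.fill_rename (E : ECtx) (t : ProofTerm) (ξ : ℕ → ℕ) :
    (E.fill t).rename ξ = (E.rename ξ).fill (t.rename ξ) := by
  induction E <;> simp_all [ECtx.fill, ECtx.rename, ProofTerm.rename]

theorem ECtx.exists_of_rename_eq_fill {r t : ProofTerm} {E : ECtx} {ξ : ℕ → ℕ}
    (h : r.rename ξ = E.fill t) :
    ∃ (E₀ : ECtx) (t₀ : ProofTerm), r = E₀.fill t₀ ∧ E₀.rename ξ = E ∧ t₀.rename ξ = t := by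
  induction E generalizing r with
  | hole => exact ⟨hole, r, rfl, rfl, h⟩
  | app E s ih =>
    cases r with
    | app a b =>
      obtain ⟨h1, rfl⟩ := ProofTerm.app.inj h
      obtain ⟨E₀, t₀, rfl, rfl, rfl⟩ := ih h1
      exact ⟨app E₀ b, t₀, rfl, rfl, rfl⟩
    | _ => cases h
  | out E ih =>
    cases r with
    | out a =>
      obtain ⟨E₀, t₀, rfl, rfl, rfl⟩ := ih (ProofTerm.out.inj h)
      exact ⟨out E₀, t₀, rfl, rfl, rfl⟩
    | _ => cases h
  | mrec s E ih =>
    cases r with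
    | mrec b a =>
      obtain ⟨rfl, h1⟩ := ProofTerm.mrec.inj h
      obtain ⟨E₀, t₀, rfl, rfl, rfl⟩ := ih h1
      exact ⟨mrec b E₀, t₀, rfl, rfl, rfl⟩
    | _ => cases h

/-! ## Strongly normalizing terms -/

theorem SN.of_rename {r : ProofTerm} {ξ : ℕ → ℕ} (hξ : ξ.Surjective) (h : SN (r.rename ξ)) :
    SN r := by
  generalize ht : r.rename ξ = t at h
  induction h generalizing r ξ with
  | var x =>
    cases r with
    | var y => exact .var y
    | _ => cases ht
  | intro t hI _ ih =>
    subst ht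
    refine .intro _ hI.of_rename fun u hu => ?_
    obtain ⟨ζ, hζ, hm⟩ := exists_rename_mem_ist hu hξ
    exact ih _ hm hζ rfl
  | elim E E' x y _ _ ih ih' =>
    obtain ⟨E₀', u, rfl, rfl, hu⟩ := ECtx.exists_of_rename_eq_fill ht
    obtain ⟨E₀, w, rfl, rfl, hw⟩ := ECtx.exists_of_rename_eq_fill hu
    cases w with
    | var x₀ =>
      obtain ⟨y₀, rfl⟩ := hξ y
      refine .elim E₀ E₀' x₀ y₀ (ih hξ hu) fun u hu => ?_
      obtain ⟨ζ, hζ, hm⟩ := exists_rename_mem_ist hu hξ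
      rw [ECtx.fill_rename] at hm
      exact ih' _ hm hζ rfl
    | _ => cases hw
  | whd E t t' _ hc _ ih ihp =>
    obtain ⟨E₀, t₀, rfl, rfl, rfl⟩ := ECtx.exists_of_rename_eq_fill ht
    obtain ⟨t₀', hc₀, rfl, hp⟩ := hc.of_rename
    exact .whd E₀ t₀ t₀' (ih hξ (ECtx.fill_rename _ _ _)) hc₀ fun u hu => ihp _ (hp u hu) hξ rfl

theorem SN.of_inst_var_zero {r : ProofTerm} (h : SN (r.inst (.var 0))) : SN r := by
  refine SN.of_rename (ξ := Nat.pred) (fun i => ⟨i + 1, rfl⟩) ?_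
  rw [rename_eq_subst]
  rw [inst_eq] at h
  convert h using 2
  funext i
  cases i <;> rfl

theorem SN.elim_app {E : ECtx} {x : ℕ} {s : ProofTerm} (h : SN (E.fill (.var x))) (hs : SN s) :
    SN (.app (E.fill (.var x)) s) :=
  SN.elim E (.app .hole s) x 0 h fun u hu => by
    rcases hu with rfl | rfl
    exacts [.var 0, hs]

theorem SN.elim_out {E : ECtx} {x : ℕ} (h : SN (E.fill (.var x))) :
    SN (.out (E.fill (.var x))) :=
  SN.elim E (.out .hole) x 0 h fun u hu => by
    rcases hu with rfl
    exact .var 0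

theorem SN.elim_mrec {E : ECtx} {x : ℕ} {s : ProofTerm} (h : SN (E.fill (.var x))) (hs : SN s) :
    SN (.mrec s (E.fill (.var x))) :=
  SN.elim E (.mrec s .hole) x 0 h fun u hu => by
    rcases hu with rfl | rfl
    exacts [hs, .var 0]

theorem SN.lam {r : ProofTerm} (h : SN r) : SN (.lam r) :=
  .intro _ (.lam r) fun _ hu => by rcases hu with rfl; exact h

theorem SN.inn {r : ProofTerm} (h : SN r) : SN (.inn r) :=
  .intro _ (.inn r) fun _ hu => by rcases hu with rfl; exact h

theorem SN.mcorec {s r : ProofTerm} (hs : SN s) (hr : SN r) : SN (.mcorec s r) :=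
  .intro _ (.mcorec s r) fun _ hu => by rcases hu with rfl | rfl; exacts [hs, hr]

/-! ## Saturated sets -/

namespace SAT

theorem sn {S : SAT} {t : ProofTerm} (h : t ∈ S) : SN t := S.2.sn t h

theorem var_mem (S : SAT) (x : ℕ) : var x ∈ S := S.2.neutral .hole x (.var x)

theorem whd (S : SAT) {t t' : ProofTerm} (E : ECtx) (h : E.fill t' ∈ S) (hc : Contract t t')
    (hp : ∀ u ∈ t.prt, SN u) : E.fill t ∈ S := S.2.whd E t t' h hc hp

theorem mem_sInf {𝒮 : Set SAT} {t : ProofTerm} : t ∈ sInf 𝒮 ↔ SN t ∧ ∀ S ∈ 𝒮, t ∈ S := Iff.rfl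

theorem mem_iInf {ι : Sort*} [Nonempty ι] {f : ι → SAT} {t : ProofTerm} :
    t ∈ (⨅ i, f i) ↔ ∀ i, t ∈ f i := by
  refine mem_sInf.trans ⟨fun h i => h.2 _ ⟨i, rfl⟩, fun h => ⟨?_, ?_⟩⟩
  · exact sn (h (Classical.arbitrary ι))
  · rintro _ ⟨i, rfl⟩
    exact h i

theorem mem_cl {X : Set ProofTerm} {t : ProofTerm} (h : t ∈ X) (hs : SN t) : t ∈ cl X :=
  mem_sInf.2 ⟨hs, fun _ hN => hN ⟨h, hs⟩⟩

theorem cl_le {X : Set ProofTerm} {S : SAT} (h : ∀ t ∈ X, SN t → t ∈ S) : cl X ≤ S :=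
  sInf_le fun t ht => h t ht.1 ht.2

theorem isSaturated_app (S T : SAT) :
    IsSaturated {r | SN r ∧ ∀ s ∈ S, ProofTerm.app r s ∈ T} where
  sn _ h := h.1
  neutral E x h := ⟨h, fun s hs => T.2.neutral (.app E s) x (h.elim_app (sn hs))⟩
  whd E t t' h hc hp := ⟨SN.whd E t t' h.1 hc hp, fun s hs => T.whd (.app E s) (h.2 s hs) hc hp⟩

theorem isSaturated_out (T : SAT) : IsSaturated {r | SN r ∧ ProofTerm.out r ∈ T} where
  sn _ h := h.1
  neutral E x h := ⟨h, T.2.neutral (.out E) x h.elim_out⟩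
  whd E t t' h hc hp := ⟨SN.whd E t t' h.1 hc hp, T.whd (.out E) h.2 hc hp⟩

theorem isSaturated_mrec {s : ProofTerm} (hs : SN s) (T : SAT) :
    IsSaturated {r | SN r ∧ ProofTerm.mrec s r ∈ T} where
  sn _ h := h.1
  neutral E x h := ⟨h, T.2.neutral (.mrec s E) x (h.elim_mrec hs)⟩
  whd E t t' h hc hp := ⟨SN.whd E t t' h.1 hc hp, T.whd (.mrec s E) h.2 hc hp⟩

theorem app_mem {S T : SAT} {r s : ProofTerm} (hr : r ∈ imp S T) (hs : s ∈ S) :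
    ProofTerm.app r s ∈ T := by
  have h : imp S T ≤ ⟨_, isSaturated_app S T⟩ := cl_le fun r hr hsn => ⟨hsn, hr⟩
  exact (h hr).2 s hs

theorem lam_mem {S T : SAT} {r : ProofTerm} (h : ∀ s ∈ S, r.inst s ∈ T) :
    ProofTerm.lam r ∈ imp S T := by
  refine mem_cl (fun s hs => T.whd .hole (h s hs) (.beta r s) ?_) ?_
  · rintro _ rfl
    exact sn hs
  · exact (SN.of_inst_var_zero (sn (h _ (S.var_mem 0)))).lam

theorem idTerm_mem {S T : SAT} (h : S ≤ T) : idTerm ∈ imp S T :=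
  lam_mem fun _ hs => h hs

theorem mrecFun_mem {S T : SAT} {s : ProofTerm} (h : ∀ r ∈ S, ProofTerm.mrec s r ∈ T) :
    mrecFun s ∈ imp S T :=
  lam_mem fun r hr => by
    simpa [inst_eq, subst, shift_subst_consSubst, subst_var, consSubst] using h r hr

theorem mcorecFun_mem {S T : SAT} {s : ProofTerm} (h : ∀ r ∈ S, ProofTerm.mcorec s r ∈ T) :
    mcorecFun s ∈ imp S T :=
  lam_mem fun r hr => by
    simpa [inst_eq, subst, shift_subst_consSubst, subst_var, consSubst] using h r hr

end SAT

/-! ## Inductive and coinductive constructions -/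

section FixedPoints

variable {M : Type*} {n : ℕ}

theorem inn_mem_muSAT (c : Fin n → M → M) (Φ : SATFun M n → SATFun M n) {t : Fin n → M}
    {r : ProofTerm} (hr : r ∈ Φ (muSAT c Φ) t) : inn r ∈ muSAT c Φ fun i => c i (t i) := by
  have h : inn r ∈ muStep c Φ (muSAT c Φ) fun i => c i (t i) :=
    SAT.mem_cl (Set.mem_biUnion (le_refl (muSAT c Φ)) ⟨t, r, rfl, hr, rfl⟩) (SAT.sn hr).inn
  exact (muStep c Φ).map_lfp.le _ h

theorem out_mem_of_mem_nuSAT (d : Fin n → M → M) (Φ : SATFun M n → SATFun M n) {t : Fin n → M}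
    {r : ProofTerm} (hr : r ∈ nuSAT d Φ t) : out r ∈ Φ (nuSAT d Φ) fun i => d i (t i) := by
  have h : nuStep d Φ (nuSAT d Φ) t ≤
      ⟨_, SAT.isSaturated_out (Φ (nuSAT d Φ) fun i => d i (t i))⟩ :=
    SAT.cl_le fun q hq _ => Set.mem_iInter₂.1 hq (nuSAT d Φ) le_rfl
  exact (h ((nuStep d Φ).map_gfp.ge t hr)).2

theorem mrec_mem (c f : Fin n → M → M) (Φ : SATFun M n → SATFun M n) (K : SATFun M n)
    {s : ProofTerm} (hsn : SN s)
    (hs : ∀ (F : SATFun M n) (p q : ProofTerm),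
      (∀ t, p ∈ SAT.imp (F t) (muSAT c Φ t)) →
      (∀ t, q ∈ SAT.imp (F t) (K fun i => f i (t i))) →
      ∀ t, ∀ r ∈ Φ F t, app (app (app s p) q) r ∈ K fun i => f i (c i (t i)))
    {t : Fin n → M} {r : ProofTerm} (hr : r ∈ muSAT c Φ t) :
    ProofTerm.mrec s r ∈ K fun i => f i (t i) := by
  let G : SATFun M n := fun t => ⟨_, SAT.isSaturated_mrec hsn (K fun i => f i (t i))⟩
  have hG : muStep c Φ (G ⊓ muSAT c Φ) ≤ G := by
    refine fun u => SAT.cl_le fun q hq hqs => ⟨hqs, ?_⟩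
    obtain ⟨F, hF, t, r, rfl, hr, rfl⟩ := Set.mem_iUnion₂.1 hq
    refine SAT.whd _ .hole (hs F idTerm (mrecFun s) (fun t => ?_) (fun t => ?_) t r hr)
      (.mrec s r) fun _ h => h.elim
    · exact SAT.idTerm_mem (hF.trans inf_le_right t)
    · exact SAT.mrecFun_mem fun r hr => (hF.trans inf_le_left t hr).2
  have hμ : muStep c Φ (G ⊓ muSAT c Φ) ≤ muSAT c Φ :=
    ((muStep c Φ).monotone inf_le_right).trans (muStep c Φ).map_lfp.le
  have h : muSAT c Φ ≤ G := ((muStep c Φ).lfp_le (le_inf hG hμ)).trans inf_le_left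
  exact (h t hr).2

theorem mcorec_mem (d f : Fin n → M → M) (Φ : SATFun M n → SATFun M n) (K : SATFun M n)
    {s : ProofTerm} (hsn : SN s)
    (hs : ∀ (F : SATFun M n) (p q : ProofTerm),
      (∀ t, p ∈ SAT.imp (nuSAT d Φ t) (F t)) →
      (∀ t, q ∈ SAT.imp (K t) (F fun i => f i (t i))) →
      ∀ t, ∀ r ∈ K t, app (app (app s p) q) r ∈ Φ F fun i => d i (f i (t i)))
    {t : Fin n → M} {r : ProofTerm} (hr : r ∈ K t) :
    ProofTerm.mcorec s r ∈ nuSAT d Φ fun i => f i (t i) := by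
  let G : SATFun M n := fun u =>
    SAT.cl {q | ∃ (t : Fin n → M) (r : ProofTerm),
      (fun i => f i (t i)) = u ∧ r ∈ K t ∧ q = ProofTerm.mcorec s r}
  have hmem (t : Fin n → M) (r : ProofTerm) (hr : r ∈ K t) :
      ProofTerm.mcorec s r ∈ G fun i => f i (t i) :=
    SAT.mem_cl ⟨t, r, rfl, hr, rfl⟩ (hsn.mcorec (SAT.sn hr))
  have hG : G ≤ nuStep d Φ (G ⊔ nuSAT d Φ) := by
    refine fun u => SAT.cl_le ?_
    rintro _ ⟨t, r, rfl, hr, rfl⟩ hqs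
    refine SAT.mem_cl (Set.mem_iInter₂.2 fun F hF => ⟨hqs, ?_⟩) hqs
    refine SAT.whd _ .hole (hs F idTerm (mcorecFun s) (fun t => ?_) (fun t => ?_) t r hr)
      (.mcorec s r) fun _ h => h.elim
    · exact SAT.idTerm_mem (le_sup_right.trans hF t)
    · exact SAT.mcorecFun_mem fun r hr => le_sup_left.trans hF _ (hmem t r hr)
  have hν : nuSAT d Φ ≤ nuStep d Φ (G ⊔ nuSAT d Φ) :=
    (nuStep d Φ).map_gfp.ge.trans ((nuStep d Φ).monotone le_sup_right)
  have h : G ≤ nuSAT d Φ := le_sup_left.trans ((nuStep d Φ).le_gfp (sup_le hG hν))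
  exact h _ (hmem t r hr)

end FixedPoints

/-! ## Interpretation and substitution -/

section Semantics

variable {L : FirstOrder.Language} {M : Type*} (𝔐 : Model L M)

open FirstOrder

theorem Model.term_var {V : Type} (v : V → M) (i : V) :
    𝔐.term v (Language.Term.var i : OTerm L V) = v i := rfl

theorem Model.term_ap1 {V : Type} (v : V → M) (f : FunSym L 1) (t : OTerm L V) :
    𝔐.term v (ap1 f t) = 𝔐.fnSym f ![𝔐.term v t] := by
  let := 𝔐.str
  refine congrArg (𝔐.fnSym f) (funext fun i => ?_)
  rw [Subsingleton.elim i 0]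
  rfl

theorem Model.term_subst {V W : Type} (w : W → M) (t : OTerm L V) (θ : V → OTerm L W) :
    𝔐.term w (t.subst θ) = 𝔐.term (fun i => 𝔐.term w (θ i)) t := by
  let := 𝔐.str
  exact Language.Term.realize_subst

theorem Model.term_relabel {V W : Type} (w : W → M) (t : OTerm L V) (g : V → W) :
    𝔐.term w (t.relabel g) = 𝔐.term (fun i => w (g i)) t := by
  let := 𝔐.str
  exact Language.Term.realize_relabel

theorem Model.term_liftFO {k l n : ℕ} (v : Fin l → M) (m : Fin n → M)
    (θ : Fin k → OTerm L (Fin l)) :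
    (fun i => 𝔐.term (Fin.append v m) (liftFO n θ i)) =
      Fin.append (fun i => 𝔐.term v (θ i)) m := by
  funext i
  refine Fin.addCases (fun i => ?_) (fun i => ?_) i
  · simp [liftFO, term_relabel]
  · simp [liftFO, term_var]

mutual

theorem Pred.interp_substFO {k l : ℕ} {Δ : List ℕ} {n : ℕ} (P : Pred L k Δ n)
    (θ : Fin k → OTerm L (Fin l)) (v : Fin l → M) (σ : SOAssign M Δ) :
    (P.substFO θ).interp 𝔐 v σ = P.interp 𝔐 (fun i => 𝔐.term v (θ i)) σ := by
  match P with
  | .var X => simp only [Pred.substFO, Pred.interp]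
  | .sym R => simp only [Pred.substFO, Pred.interp]
  | .compr A =>
    funext m
    simp only [Pred.substFO, Pred.interp]
    rw [Form.interp_substFO A, 𝔐.term_liftFO]
  | .mu Φ c => simp only [Pred.substFO, Pred.interp]
  | .nu Φ c => simp only [Pred.substFO, Pred.interp]

theorem Form.interp_substFO {k l : ℕ} {Δ : List ℕ} (A : Form L k Δ)
    (θ : Fin k → OTerm L (Fin l)) (v : Fin l → M) (σ : SOAssign M Δ) :
    (A.substFO θ).interp 𝔐 v σ = A.interp 𝔐 (fun i => 𝔐.term v (θ i)) σ := by
  match A with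
  | .app P t =>
    simp only [Form.substFO, Form.interp, Model.term_subst]
    rw [Pred.interp_substFO P]
  | .imp A B =>
    simp only [Form.substFO, Form.interp]
    rw [Form.interp_substFO A, Form.interp_substFO B]
  | .all A =>
    simp only [Form.substFO, Form.interp]
    refine iInf_congr fun m => ?_
    rw [Form.interp_substFO A, 𝔐.term_liftFO]
  | .all2 n A =>
    simp only [Form.substFO, Form.interp]
    refine iInf_congr fun G => ?_
    rw [Form.interp_substFO A]

end

theorem Pred.interp_weakFO {k n m : ℕ} {Δ : List ℕ} (P : Pred L k Δ m) (v : Fin k → M)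
    (w : Fin n → M) (σ : SOAssign M Δ) :
    (P.weakFO n).interp 𝔐 (Fin.append v w) σ = P.interp 𝔐 v σ := by
  simp [Pred.weakFO, Pred.interp_substFO, Model.term_var]

theorem Form.interp_weakFO {k n : ℕ} {Δ : List ℕ} (A : Form L k Δ) (v : Fin k → M)
    (w : Fin n → M) (σ : SOAssign M Δ) :
    (A.weakFO n).interp 𝔐 (Fin.append v w) σ = A.interp 𝔐 v σ := by
  simp [Form.weakFO, Form.interp_substFO, Model.term_var]

theorem Form.interp_instFO {k n : ℕ} {Δ : List ℕ} (A : Form L (k + n) Δ)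
    (t : Fin n → OTerm L (Fin k)) (v : Fin k → M) (σ : SOAssign M Δ) :
    (A.instFO t).interp 𝔐 v σ = A.interp 𝔐 (Fin.append v fun i => 𝔐.term v (t i)) σ := by
  rw [Form.instFO, Form.interp_substFO]
  congr 1
  funext i
  refine Fin.addCases (fun i => ?_) (fun i => ?_) i <;> simp [Model.term_var]

theorem SOAssign.push_liftRenSO {Δ Δ' : List ℕ} {m : ℕ} (ξ : ∀ n, SVar Δ n → SVar Δ' n)
    (σ : SOAssign M Δ') (G : SATFun M m) :
    (fun n X => σ.push G n (liftRenSO ξ n X)) = SOAssign.push (fun n X => σ n (ξ n X)) G := by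
  funext n X
  cases X <;> rfl

mutual

theorem Pred.interp_renSO {k : ℕ} {Δ Δ' : List ℕ} {n : ℕ} (P : Pred L k Δ n)
    (ξ : ∀ n, SVar Δ n → SVar Δ' n) (v : Fin k → M) (σ : SOAssign M Δ') :
    (P.renSO ξ).interp 𝔐 v σ = P.interp 𝔐 v fun n X => σ n (ξ n X) := by
  match P with
  | .var X => simp only [Pred.renSO, Pred.interp]
  | .sym R => simp only [Pred.renSO, Pred.interp]
  | .compr A =>
    funext m
    simp only [Pred.renSO, Pred.interp]
    rw [Form.interp_renSO A]
  | .mu Φ c => simp only [Pred.renSO, Pred.interp]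
  | .nu Φ c => simp only [Pred.renSO, Pred.interp]

theorem Form.interp_renSO {k : ℕ} {Δ Δ' : List ℕ} (A : Form L k Δ)
    (ξ : ∀ n, SVar Δ n → SVar Δ' n) (v : Fin k → M) (σ : SOAssign M Δ') :
    (A.renSO ξ).interp 𝔐 v σ = A.interp 𝔐 v fun n X => σ n (ξ n X) := by
  match A with
  | .app P t =>
    simp only [Form.renSO, Form.interp]
    rw [Pred.interp_renSO P]
  | .imp A B =>
    simp only [Form.renSO, Form.interp]
    rw [Form.interp_renSO A, Form.interp_renSO B]
  | .all A =>
    simp only [Form.renSO, Form.interp]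
    refine iInf_congr fun m => ?_
    rw [Form.interp_renSO A]
  | .all2 n A =>
    simp only [Form.renSO, Form.interp]
    refine iInf_congr fun G => ?_
    rw [Form.interp_renSO A, SOAssign.push_liftRenSO]

end

theorem Pred.interp_weakSO {k m n : ℕ} {Δ : List ℕ} (P : Pred L k Δ n) (v : Fin k → M)
    (σ : SOAssign M Δ) (G : SATFun M m) :
    (P.weakSO m).interp 𝔐 v (σ.push G) = P.interp 𝔐 v σ :=
  Pred.interp_renSO 𝔐 P _ v _

theorem Form.interp_weakSO {k m : ℕ} {Δ : List ℕ} (A : Form L k Δ) (v : Fin k → M)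
    (σ : SOAssign M Δ) (G : SATFun M m) :
    (A.weakSO m).interp 𝔐 v (σ.push G) = A.interp 𝔐 v σ :=
  Form.interp_renSO 𝔐 A _ v _

theorem SOAssign.push_liftSO {k m : ℕ} {Δ Δ' : List ℕ} (Θ : ∀ n, SVar Δ n → Pred L k Δ' n)
    (v : Fin k → M) (σ : SOAssign M Δ') (G : SATFun M m) :
    (fun n X => (liftSO (m := m) Θ n X).interp 𝔐 v (σ.push G)) =
      SOAssign.push (fun n X => (Θ n X).interp 𝔐 v σ) G := by
  funext n X
  cases X with
  | zero => simp only [liftSO, Pred.interp, SOAssign.push]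
  | succ X => simp only [liftSO, Pred.interp_weakSO, SOAssign.push]

mutual

theorem Pred.interp_substSO {k : ℕ} {Δ Δ' : List ℕ} {n : ℕ} (P : Pred L k Δ n)
    (Θ : ∀ n, SVar Δ n → Pred L k Δ' n) (v : Fin k → M) (σ : SOAssign M Δ') :
    (P.substSO Θ).interp 𝔐 v σ = P.interp 𝔐 v fun n X => (Θ n X).interp 𝔐 v σ := by
  match P with
  | .var X => simp only [Pred.substSO, Pred.interp]
  | .sym R => simp only [Pred.substSO, Pred.interp]
  | .compr A =>
    funext m
    simp only [Pred.substSO, Pred.interp]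
    rw [Form.interp_substSO A]
    simp only [Pred.interp_weakFO]
  | .mu Φ c => simp only [Pred.substSO, Pred.interp]
  | .nu Φ c => simp only [Pred.substSO, Pred.interp]

theorem Form.interp_substSO {k : ℕ} {Δ Δ' : List ℕ} (A : Form L k Δ)
    (Θ : ∀ n, SVar Δ n → Pred L k Δ' n) (v : Fin k → M) (σ : SOAssign M Δ') :
    (A.substSO Θ).interp 𝔐 v σ = A.interp 𝔐 v fun n X => (Θ n X).interp 𝔐 v σ := by
  match A with
  | .app P t =>
    simp only [Form.substSO, Form.interp]
    rw [Pred.interp_substSO P]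
  | .imp A B =>
    simp only [Form.substSO, Form.interp]
    rw [Form.interp_substSO A, Form.interp_substSO B]
  | .all A =>
    simp only [Form.substSO, Form.interp]
    refine iInf_congr fun m => ?_
    rw [Form.interp_substSO A]
    simp only [Pred.interp_weakFO]
  | .all2 n A =>
    simp only [Form.substSO, Form.interp]
    refine iInf_congr fun G => ?_
    rw [Form.interp_substSO A, SOAssign.push_liftSO]

end

theorem SOAssign.push_oneSO {k m : ℕ} {Δ : List ℕ} (R : Pred L k Δ m) (v : Fin k → M)
    (σ : SOAssign M Δ) :
    (fun n X => (oneSO R n X).interp 𝔐 v σ) = σ.push (R.interp 𝔐 v σ) := by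
  funext n X
  cases X <;> simp only [oneSO, Pred.interp, SOAssign.push]

theorem Form.interp_instSO {k m : ℕ} {Δ : List ℕ} (A : Form L k (m :: Δ)) (R : Pred L k Δ m)
    (v : Fin k → M) (σ : SOAssign M Δ) :
    (A.instSO R).interp 𝔐 v σ = A.interp 𝔐 v (σ.push (R.interp 𝔐 v σ)) := by
  rw [Form.instSO, Form.interp_substSO, SOAssign.push_oneSO]

theorem Pred.interp_transApp {k n : ℕ} {Δ : List ℕ} (Φ : Pred L 0 [n] n) (R : Pred L k Δ n)
    (v : Fin k → M) (σ : SOAssign M Δ) :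
    (Φ.transApp R).interp 𝔐 v σ =
      Φ.interp 𝔐 Fin.elim0 (SOAssign.empty.push (R.interp 𝔐 v σ)) := by
  rw [Pred.transApp, Pred.interp_substSO, SOAssign.push_oneSO, Pred.interp_renSO,
    Pred.interp_substFO]
  congr 1
  · exact Subsingleton.elim _ _
  · funext m X
    cases X with
    | zero => rfl
    | succ X => cases X

theorem Form.mem_interp_alls [Nonempty M] {k n : ℕ} {Δ : List ℕ} (A : Form L (k + n) Δ)
    (v : Fin k → M) (σ : SOAssign M Δ) (t : ProofTerm) :
    t ∈ (Form.alls n A).interp 𝔐 v σ ↔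
      ∀ m : Fin n → M, t ∈ A.interp 𝔐 (Fin.append v m) σ := by
  induction n with
  | zero =>
    have h (m : Fin 0 → M) : Fin.append v m = v := by
      rw [Subsingleton.elim m Fin.elim0]
      exact Fin.append_elim0 v
    simp only [Form.alls, h, forall_const]
  | succ n ih =>
    have h (m : Fin n → M) (x : M) :
        Fin.append (Fin.append v m) ![x] = Fin.append v (Fin.snoc m x : Fin (n + 1) → M) := by
      rw [Fin.append_snoc, Fin.append_right_eq_snoc]
      rfl
    simp only [Form.alls, ih, Form.interp, SAT.mem_iInf, h]
    refine ⟨fun H m => ?_, fun H m x => H _⟩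
    rw [← Fin.snoc_init_self m]
    exact H _ _

theorem mem_interp_subAlong [Nonempty M] {k n : ℕ} {Δ : List ℕ} (g : Fin n → FunSym L 1)
    (P R : Pred L k Δ n) (v : Fin k → M) (σ : SOAssign M Δ) (t : ProofTerm) :
    t ∈ (subAlong g P R).interp 𝔐 v σ ↔
      ∀ m : Fin n → M, t ∈ SAT.imp (P.interp 𝔐 v σ m)
        (R.interp 𝔐 v σ fun i => 𝔐.fnSym (g i) ![m i]) := by
  simp [subAlong, Form.mem_interp_alls, Form.interp, Pred.interp_weakFO, Model.term_var,
    Model.term_ap1]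

theorem mem_interp_sub [Nonempty M] {k n : ℕ} {Δ : List ℕ} (P R : Pred L k Δ n)
    (v : Fin k → M) (σ : SOAssign M Δ) (t : ProofTerm) :
    t ∈ (sub P R).interp 𝔐 v σ ↔
      ∀ m : Fin n → M, t ∈ SAT.imp (P.interp 𝔐 v σ m) (R.interp 𝔐 v σ m) := by
  simp [sub, Form.mem_interp_alls, Form.interp, Pred.interp_weakFO, Model.term_var]

mutual

theorem PredConv.interp_eq {k : ℕ} {Δ : List ℕ} {n : ℕ} {P Q : Pred L k Δ n}
    (h : PredConv P Q) : P.interp 𝔐 = Q.interp 𝔐 := by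
  match h with
  | .refl _ => rfl
  | .compr h => simp only [Pred.interp, FormConv.interp_eq h]
  | .mu c h => simp only [Pred.interp, PredConv.interp_eq h]
  | .nu d h => simp only [Pred.interp, PredConv.interp_eq h]

theorem FormConv.interp_eq {k : ℕ} {Δ : List ℕ} {A B : Form L k Δ}
    (h : FormConv A B) : A.interp 𝔐 = B.interp 𝔐 := by
  match h with
  | .beta A t =>
    funext v σ
    rw [Form.interp_instFO]
    simp only [Form.interp, Pred.interp]
  | .refl _ => rfl
  | .symm h => exact (FormConv.interp_eq h).symm
  | .trans h h' => exact (FormConv.interp_eq h).trans (FormConv.interp_eq h')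
  | .app t h => simp only [Form.interp, PredConv.interp_eq h]
  | .imp h h' => simp only [Form.interp, FormConv.interp_eq h, FormConv.interp_eq h']
  | .all h => simp only [Form.interp, FormConv.interp_eq h]
  | .all2 h => simp only [Form.interp, FormConv.interp_eq h]

end

theorem EqDer.term_eq {E : Set (Equation L)} (hE : ∀ w : ℕ → M, 𝔐.Satisfies w E) {V : Type}
    {r s : OTerm L V} (h : EqDer E r s) (v : V → M) : 𝔐.term v r = 𝔐.term v s := by
  induction h with
  | inst r s t h => rw [Model.term_subst, Model.term_subst, hE _ r s h]
  | inst' r s t h => rw [Model.term_subst, Model.term_subst, hE _ r s h]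
  | comp f g t => simp only [Model.term_ap1, Model.fnSym]
  | comp' f g t => simp only [Model.term_ap1, Model.fnSym]
  | refl r => rfl
  | trans _ _ _ _ _ ih ih' => exact ih.trans ih'
  | func f r s _ ih => exact congrArg (𝔐.fnSym f) (funext ih)

theorem Derives.subst_mem_interp [Nonempty M] {E : Set (Equation L)}
    (hE : ∀ w : ℕ → M, 𝔐.Satisfies w E) {k : ℕ} {Δ : List ℕ} {Γ : List (Form L k Δ)}
    {t : ProofTerm} {A : Form L k Δ} (h : Derives E Γ t A) (v : Fin k → M) (σ : SOAssign M Δ)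
    (τ : ℕ → ProofTerm) (hτ : ∀ i B, Γ[i]? = some B → τ i ∈ B.interp 𝔐 v σ) :
    t.subst τ ∈ A.interp 𝔐 v σ := by
  induction h generalizing τ with
  | var i => exact hτ i _ (by simp)
  | impI _ ih =>
    simp only [Form.interp]
    refine SAT.lam_mem fun s hs => ?_
    rw [subst_liftSubst_inst]
    refine ih v σ _ fun i B hB => ?_
    cases i with
    | zero => cases hB; exact hs
    | succ i => exact hτ i B hB
  | impE _ _ ih ih' =>
    have h := ih v σ τ hτ
    simp only [Form.interp] at h
    exact SAT.app_mem h (ih' v σ τ hτ)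
  | allI _ ih =>
    simp only [Form.interp, SAT.mem_iInf]
    refine fun m => ih _ σ τ fun i B hB => ?_
    rw [List.getElem?_map, Option.map_eq_some_iff] at hB
    obtain ⟨C, hC, rfl⟩ := hB
    rw [Form.interp_weakFO]
    exact hτ i C hC
  | allE r _ ih =>
    have h := ih v σ τ hτ
    simp only [Form.interp, SAT.mem_iInf] at h
    have hr : (fun i => 𝔐.term v (![r] i)) = ![𝔐.term v r] :=
      funext (Fin.forall_fin_one.2 rfl)
    rw [Form.interp_instFO, hr]
    exact h _
  | all2I _ ih =>
    simp only [Form.interp, SAT.mem_iInf]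
    refine fun G => ih v _ τ fun i B hB => ?_
    rw [List.getElem?_map, Option.map_eq_some_iff] at hB
    obtain ⟨C, hC, rfl⟩ := hB
    rw [Form.interp_weakSO]
    exact hτ i C hC
  | all2E P _ ih =>
    have h := ih v σ τ hτ
    simp only [Form.interp, SAT.mem_iInf] at h
    rw [Form.interp_instSO]
    exact h _
  | eq _ hrs ih =>
    have h := ih v σ τ hτ
    rw [Form.interp_instFO] at h ⊢
    simpa [hrs.term_eq 𝔐 hE v] using h
  | conv _ hc ih => exact hc.interp_eq 𝔐 ▸ ih v σ τ hτ
  | @muI _ _ _ _ _ Φ _ _ _ ih =>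
    have h := ih v σ τ hτ
    simp only [Form.interp, Pred.interp_transApp, Pred.interp, Model.term_ap1] at h ⊢
    exact inn_mem_muSAT _
      (fun F => Φ.interp 𝔐 Fin.elim0 (SOAssign.empty.push F)) h
  | @nuE _ _ _ _ _ Φ _ _ _ ih =>
    have h := ih v σ τ hτ
    simp only [Form.interp, Pred.interp_transApp, Pred.interp, Model.term_ap1] at h ⊢
    exact out_mem_of_mem_nuSAT _
      (fun F => Φ.interp 𝔐 Fin.elim0 (SOAssign.empty.push F)) h
  | @muE k Δ n Γ s r Φ c f K t _ _ ih ih' =>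
    have h := ih v σ τ hτ
    have h' := ih' v σ τ hτ
    have hsn := SAT.sn h
    simp only [Form.interp, SAT.mem_iInf] at h
    simp only [Form.interp, Pred.interp, Model.term_ap1] at h' ⊢
    refine mrec_mem _ (fun i x => 𝔐.fnSym (f i) ![x]) _ _ hsn (fun F p q hp hq t r hr => ?_) h'
    have h1 := SAT.app_mem (s := p) (h F) ((mem_interp_sub ..).2 ?_)
    have h2 := SAT.app_mem (s := q) h1 ((mem_interp_subAlong ..).2 ?_)
    have h3 := (mem_interp_subAlong ..).1 h2 t
    · rw [Pred.interp_transApp, Pred.interp_weakSO] at h3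
      exact SAT.app_mem h3 (by simpa only [Pred.interp, SOAssign.push] using hr)
    · simpa only [Pred.interp_weakSO, Pred.interp, SOAssign.push] using hq
    · simpa only [Pred.interp, SOAssign.push] using hp
  | @nuI k Δ n Γ s r Φ d f K t _ _ ih ih' =>
    have h := ih v σ τ hτ
    have h' := ih' v σ τ hτ
    have hsn := SAT.sn h
    simp only [Form.interp, SAT.mem_iInf] at h
    simp only [Form.interp, Pred.interp, Model.term_ap1] at h' ⊢
    refine mcorec_mem _ (fun i x => 𝔐.fnSym (f i) ![x]) _ _ hsn
      (fun F p q hp hq t r hr => ?_) h'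
    have h1 := SAT.app_mem (s := p) (h F) ((mem_interp_sub ..).2 ?_)
    have h2 := SAT.app_mem (s := q) h1 ((mem_interp_subAlong ..).2 ?_)
    have h3 := (mem_interp_subAlong ..).1 h2 t
    · rw [Pred.interp_transApp, Pred.interp_weakSO] at h3
      exact SAT.app_mem h3 hr
    · simpa only [Pred.interp_weakSO, Pred.interp, SOAssign.push] using hq
    · simpa only [Pred.interp, SOAssign.push] using hp

end Semantics

end AF2

theorem mainTheorem2 {L : FirstOrder.Language} {M : Type*} [Nonempty M] (𝔐 : AF2.Model L M)
    (E : Set (AF2.Equation L)) (hE : ∀ w : ℕ → M, 𝔐.Satisfies w E)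
    {k : ℕ} {Δ : List ℕ} (v : Fin k → M) (σ : AF2.SOAssign M Δ)
    (Γ : List (AF2.Form L k Δ)) (t : AF2.ProofTerm) (A : AF2.Form L k Δ)
    (ht : AF2.Derives E Γ t A)
    (r : Fin Γ.length → AF2.ProofTerm) (hr : ∀ i, r i ∈ (Γ.get i).interp 𝔐 v σ) :
    t.substTuple r ∈ A.interp 𝔐 v σ := by
  refine ht.subst_mem_interp 𝔐 hE v σ _ fun i B hB => ?_
  obtain ⟨hi, rfl⟩ := List.getElem?_eq_some_iff.1 hB
  rw [dif_pos hi]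
  exact hr ⟨i, hi⟩
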